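/- For a nonzero polynomial $F(x,y)\in\mathbb C[x,y]$ let $$\mathrm m(F)=\frac1{(2\pi i)^2}\iint_{|x|=|y|=1}\log|F(x,y)|\,\frac{dx}{x}\,\frac{dy}{y}=\frac1{4\pi^2}\int_0^{2\pi}\!\!\int_0^{2\pi}\log|F(e^{is},e^{it})|\,ds\,dt$$ denote its (logarithmic) Mahler measure. For real $k$ let $$P_k(x,y)=(x^2+x+1)y^2+kx(x+1)y+x(x^2+x+1)$$ and $$Q_k(x,y)=(x^2+x+1)y^2+(x^4+kx^3+(2k-4)x^2+kx+1)y+x^2(x^2+x+1).$$ Then for every real $k\ge4$ the integrals defining $\mathrm m(P_k)$ and $\mathrm m(Q_{k+2})$ converge absolutely, and $$\mathrm m(P_k)=\mathrm m(Q_{k+2}).$$ -/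

import Mathlib

open MvPolynomial in
/-- The polynomial `P_k(x,y) = (x²+x+1)y² + kx(x+1)y + x(x²+x+1)`,
with `x = X 0` and `y = X 1`. -/
noncomputable def boydP (k : ℝ) : MvPolynomial (Fin 2) ℂ :=
  (X 0 ^ 2 + X 0 + 1) * X 1 ^ 2
    + C (k : ℂ) * X 0 * (X 0 + 1) * X 1
    + X 0 * (X 0 ^ 2 + X 0 + 1)

open MvPolynomial in
/-- The polynomial `Q_k(x,y) = (x²+x+1)y² + (x⁴+kx³+(2k-4)x²+kx+1)y + x²(x²+x+1)`,
with `x = X 0` and `y = X 1`. -/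
noncomputable def boydQ (k : ℝ) : MvPolynomial (Fin 2) ℂ :=
  (X 0 ^ 2 + X 0 + 1) * X 1 ^ 2
    + (X 0 ^ 4 + C (k : ℂ) * X 0 ^ 3 + C (2 * (k : ℂ) - 4) * X 0 ^ 2
        + C (k : ℂ) * X 0 + 1) * X 1
    + X 0 ^ 2 * (X 0 ^ 2 + X 0 + 1)

/-- The function `(s, t) ↦ log |F(e^{is}, e^{it})|`. -/
noncomputable def logNormOnTorus (F : MvPolynomial (Fin 2) ℂ) (θ : ℝ × ℝ) : ℝ :=
  Real.log ‖MvPolynomial.eval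
    ![Complex.exp (θ.1 * Complex.I), Complex.exp (θ.2 * Complex.I)] F‖

/-- A fundamental domain `(0, 2π] × (0, 2π]` for the angles on the torus `|x| = |y| = 1`. -/
def torusAngles : Set (ℝ × ℝ) :=
  Set.Ioc 0 (2 * Real.pi) ×ˢ Set.Ioc 0 (2 * Real.pi)

/-- The (logarithmic) Mahler measure of a two-variate polynomial,
`m(F) = (2πi)⁻² ∬_{|x|=|y|=1} log |F(x,y)| (dx/x) (dy/y)`,
written with `x = e^{is}`, `y = e^{it}`, so that `dx/x = i ds` and `dy/y = i dt`. -/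
noncomputable def logMahlerMeasure₂ (F : MvPolynomial (Fin 2) ℂ) : ℝ :=
  ((2 * Real.pi) ^ 2)⁻¹ * ∫ θ in torusAngles, logNormOnTorus F θ

/-! Up to a monomial of modulus 1, both polynomials restrict to the torus as `2 A cos (t - c) + B`
with the same `A = 1 + 2 cos s`. Jensen's formula in `t` turns each slice into `log |A| + arcosh⁺ |B
/ (2A)|`, so only the arcosh terms `sliceP` and `sliceQ` need comparing. With `u = 2 + 2 cos s`,
their arguments are affine in `k`.

Differentiating in `k` and passing from `s` to `u` gives two elliptic integrals, which a Möbius map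
of `u` carries into each other (`lintegral_elliptic_eq`). Hence the difference of the two integrals
is constant for `k ≥ 4` (`integral_sliceP_sub_eq`). As `k → ∞` the integrands differ by `-(1/2) log
u` in the limit, and `∫ log (2 + 2 cos s) ds = 0`, so dominated convergence makes that constant zero
(`tendsto_integral_sliceP_sub_sliceQ`). -/

open MeasureTheory Set Filter Topology

/-! ### Jensen's formula for reciprocal quadratics -/

/-- The nonnegative extension of `arcosh` by zero below `1`. -/
noncomputable def posArcosh (b : ℝ) : ℝ := Real.arcosh (max 1 b)

lemma posArcosh_nonneg (b : ℝ) : 0 ≤ posArcosh b := Real.arcosh_nonneg (le_max_left _ _)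

lemma posArcosh_of_le {b : ℝ} (hb : b ≤ 1) : posArcosh b = 0 := by
  rw [posArcosh, max_eq_left hb, Real.arcosh_zero]

lemma posArcosh_of_ge {b : ℝ} (hb : 1 ≤ b) : posArcosh b = Real.log (b + √(b ^ 2 - 1)) := by
  rw [posArcosh, max_eq_right hb, Real.arcosh]

lemma continuous_posArcosh : Continuous posArcosh :=
  Real.continuousOn_arcosh.comp_continuous (by fun_prop) fun b => le_max_left 1 b

/-- A reciprocal pair of complex numbers with prescribed real sum `-2b`. -/
lemma exists_reciprocal_pair (b : ℝ) : ∃ r₁ r₂ : ℂ, r₁ + r₂ = -(2 * b : ℝ) ∧ r₁ * r₂ = 1 ∧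
    Real.posLog ‖r₁‖ + Real.posLog ‖r₂‖ = posArcosh |b| := by
  -- The roots of `y² + 2by + 1` are a conjugate pair on the unit circle if `|b| ≤ 1`; otherwise
  -- they are real and inverse to each other, and only the larger in modulus contributes.
  rcases le_or_gt |b| 1 with hb | hb
  · have h0 : 0 ≤ 1 - b ^ 2 := by
      have := (sq_le_one_iff_abs_le_one b).2 hb
      linarith
    have hs := Real.sq_sqrt h0
    have hI := Complex.I_sq
    have hsc : ((√(1 - b ^ 2) : ℝ) : ℂ) ^ 2 = 1 - (b : ℂ) ^ 2 := by exact_mod_cast hs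
    have n1 : ‖(-b : ℂ) + √(1 - b ^ 2) * Complex.I‖ = 1 := by
      have := Complex.norm_add_mul_I (-b) √(1 - b ^ 2)
      push_cast at this
      rw [this, hs]; simp
    have n2 : ‖(-b : ℂ) - √(1 - b ^ 2) * Complex.I‖ = 1 := by
      have := Complex.norm_add_mul_I (-b) (-√(1 - b ^ 2))
      push_cast at this
      rw [sub_eq_add_neg, ← neg_mul, this, neg_sq √(1 - b ^ 2), hs]; simp
    refine ⟨-b + √(1 - b ^ 2) * Complex.I, -b - √(1 - b ^ 2) * Complex.I, ?_, ?_, ?_⟩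
    · push_cast; ring
    · linear_combination (-Complex.I ^ 2) * hsc - (1 - (b : ℂ) ^ 2) * hI
    · rw [n1, n2, posArcosh_of_le hb]; simp
  · have h0 : 0 ≤ |b| ^ 2 - 1 := by nlinarith
    have hs := Real.sq_sqrt h0
    have hp := Real.sqrt_nonneg (|b| ^ 2 - 1)
    set w := √(|b| ^ 2 - 1) with hw
    have hsum : Real.posLog (|b| + w) + Real.posLog (|b| - w) = posArcosh |b| := by
      have h1 : (1 : ℝ) ≤ |b| + w := by linarith
      have h2 : 0 ≤ |b| - w := by nlinarith
      have h3 : |b| - w ≤ 1 := by nlinarith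
      rw [posArcosh_of_ge hb.le, Real.posLog_eq_log (by rwa [abs_of_nonneg (by linarith)]),
        Real.posLog_eq_zero_iff _ |>.2 (by rwa [abs_of_nonneg h2]), add_zero]
    have hn1 : ‖((|b| + w : ℝ) : ℂ)‖ = |b| + w := by
      rw [Complex.norm_real, Real.norm_of_nonneg (by positivity)]
    have hn2 : ‖((|b| - w : ℝ) : ℂ)‖ = |b| - w := by
      rw [Complex.norm_real, Real.norm_of_nonneg (by nlinarith)]
    have hm : ((|b| + w : ℝ) : ℂ) * ((|b| - w : ℝ) : ℂ) = 1 := by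
      rw [← Complex.ofReal_mul, ← Complex.ofReal_one]; congr 1; nlinarith
    rcases abs_choice b with h | h
    · refine ⟨-((|b| + w : ℝ) : ℂ), -((|b| - w : ℝ) : ℂ), ?_, by rw [neg_mul_neg, hm], ?_⟩
      · rw [h]; push_cast; ring
      · rw [norm_neg, norm_neg, hn1, hn2, hsum]
    · refine ⟨((|b| + w : ℝ) : ℂ), ((|b| - w : ℝ) : ℂ), ?_, hm, ?_⟩
      · rw [h]; push_cast; ring
      · rw [hn1, hn2, hsum]

/-- The self-reciprocal real quadratic `A y² + B y + A`. -/
noncomputable def reciprocalQuadratic (A B : ℝ) : Polynomial ℂ :=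
  .C (A : ℂ) * .X ^ 2 + .C (B : ℂ) * .X + .C (A : ℂ)

lemma logMahlerMeasure_reciprocalQuadratic {A : ℝ} (hA : A ≠ 0) (B : ℝ) :
    (reciprocalQuadratic A B).logMahlerMeasure = Real.log |A| + posArcosh |B / (2 * A)| := by
  obtain ⟨r₁, r₂, hs, hm, hl⟩ := exists_reciprocal_pair (B / (2 * A))
  have hAc : (A : ℂ) ≠ 0 := by exact_mod_cast hA
  have hB : (B : ℂ) = -(A * (r₁ + r₂)) := by
    rw [hs]; push_cast; field_simp
  have hfac : reciprocalQuadratic A B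
      = .C (A : ℂ) * ((.X - .C r₁) * (.X - .C r₂)) := by
    have hm' : (.C r₁ * .C r₂ : Polynomial ℂ) = 1 := by rw [← Polynomial.C_mul, hm, map_one]
    rw [reciprocalQuadratic, hB]
    simp only [map_neg, map_mul, map_add]
    linear_combination (-.C (A : ℂ) : Polynomial ℂ) * hm'
  have hX : ((.X - .C r₁) * (.X - .C r₂) : Polynomial ℂ) ≠ 0 :=
    mul_ne_zero (Polynomial.X_sub_C_ne_zero _) (Polynomial.X_sub_C_ne_zero _)
  rw [hfac, Polynomial.logMahlerMeasure_C_mul hAc hX,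
    Polynomial.logMahlerMeasure_mul_eq_add_logMahlerMeasure hX,
    Polynomial.logMahlerMeasure_X_sub_C, Polynomial.logMahlerMeasure_X_sub_C, hl,
    Complex.norm_real, Real.norm_eq_abs]

lemma norm_eval_reciprocalQuadratic (A B t : ℝ) :
    ‖(reciprocalQuadratic A B).eval (circleMap 0 1 t)‖ = |2 * A * Real.cos t + B| := by
  have h : (reciprocalQuadratic A B).eval (circleMap 0 1 t)
      = Complex.exp (t * Complex.I) * ((2 * A * Real.cos t + B : ℝ) : ℂ) := by
    have hc := Complex.two_cos (t : ℂ)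
    have he : Complex.exp (t * Complex.I) * Complex.exp (-t * Complex.I) = 1 := by
      rw [← Complex.exp_add]; simp
    simp only [reciprocalQuadratic, circleMap_zero, Complex.ofReal_one, one_mul,
      Polynomial.eval_add, Polynomial.eval_mul, Polynomial.eval_C, Polynomial.eval_pow,
      Polynomial.eval_X]
    push_cast
    linear_combination (-(A : ℂ) * Complex.exp (t * Complex.I)) * hc - A * he
  rw [h, norm_mul, Complex.norm_exp_ofReal_mul_I, one_mul, Complex.norm_real, Real.norm_eq_abs]

lemma intervalIntegrable_log_abs_cos_add (A B c : ℝ) :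
    IntervalIntegrable (fun t => Real.log |2 * A * Real.cos (t - c) + B|) volume
      0 (2 * Real.pi) := by
  have h := (reciprocalQuadratic A B).intervalIntegrable_mahlerMeasure
  simp only [norm_eval_reciprocalQuadratic] at h
  have hp : Function.Periodic (fun t => Real.log |2 * A * Real.cos t + B|) (2 * Real.pi) := by
    simp [Function.Periodic]
  have h2 := (hp.intervalIntegrable₀ Real.two_pi_pos.ne' h (0 - c) (2 * Real.pi - c)).comp_sub_right c
  simpa using h2

lemma integral_log_abs_cos_add {A : ℝ} (hA : A ≠ 0) (B c : ℝ) :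
    ∫ t in 0..2 * Real.pi, Real.log |2 * A * Real.cos (t - c) + B|
      = 2 * Real.pi * (Real.log |A| + posArcosh |B / (2 * A)|) := by
  have hp : Function.Periodic (fun t => Real.log |2 * A * Real.cos t + B|) (2 * Real.pi) := by
    simp [Function.Periodic]
  have h1 : ∫ t in 0..2 * Real.pi, Real.log |2 * A * Real.cos (t - c) + B|
      = ∫ t in 0..2 * Real.pi, Real.log |2 * A * Real.cos t + B| := by
    rw [intervalIntegral.integral_comp_sub_right
      (fun t => Real.log |2 * A * Real.cos t + B|) c]
    have := hp.intervalIntegral_add_eq (0 - c) 0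
    rwa [zero_add, show 0 - c + 2 * Real.pi = 2 * Real.pi - c by ring] at this
  have h2 := logMahlerMeasure_reciprocalQuadratic hA B
  rw [Polynomial.logMahlerMeasure_def, Real.circleAverage_def] at h2
  simp only [norm_eval_reciprocalQuadratic, smul_eq_mul] at h2
  rw [h1, ← h2]
  have := Real.pi_ne_zero
  field_simp

/-- For a function bounded above by `M`, this controls the L¹ norm of its logarithm by the integral
of the logarithm, which Jensen's formula evaluates. At `y = 0` it relies on `Real.log 0 = 0`. -/
lemma abs_log_le_two_mul_log_sub {y M : ℝ} (hy : 0 ≤ y) (hyM : y ≤ M) (hM : 1 ≤ M) :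
    |Real.log y| ≤ 2 * Real.log M - Real.log y := by
  have hM0 := Real.log_nonneg hM
  rcases hy.eq_or_lt with rfl | hy
  · simp [hM0]
  · have := Real.log_le_log hy hyM
    rw [abs_le]; constructor <;> linarith

/-- Jensen's formula applied to the slices of `2 A(s) cos (t - c(s)) + B(s)`. -/
lemma integrableOn_torusAngles_log_abs_cos_add {A B c : ℝ → ℝ} (hA : Continuous A)
    (hB : Continuous B) (hc : Continuous c) {M : ℝ} (hM : 1 ≤ M)
    (hAB : ∀ s, 2 * |A s| + |B s| ≤ M) (hA0 : ∀ᵐ s, A s ≠ 0)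
    (hlog : IntegrableOn (fun s => Real.log |A s|) (Ioc 0 (2 * Real.pi))) :
    IntegrableOn (fun θ : ℝ × ℝ => Real.log |2 * A θ.1 * Real.cos (θ.2 - c θ.1) + B θ.1|)
      torusAngles ∧
    IntegrableOn (fun s => posArcosh |B s / (2 * A s)|) (Ioc 0 (2 * Real.pi)) ∧
    ∫ θ in torusAngles, Real.log |2 * A θ.1 * Real.cos (θ.2 - c θ.1) + B θ.1|
      = 2 * Real.pi * ((∫ s in Ioc 0 (2 * Real.pi), Real.log |A s|)
        + ∫ s in Ioc 0 (2 * Real.pi), posArcosh |B s / (2 * A s)|) := by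
  have hpi := Real.two_pi_pos
  set I := Ioc 0 (2 * Real.pi) with hI
  set G := fun θ : ℝ × ℝ => Real.log |2 * A θ.1 * Real.cos (θ.2 - c θ.1) + B θ.1| with hG
  have hvol : (volume.restrict torusAngles : Measure (ℝ × ℝ))
      = (volume.restrict I).prod (volume.restrict I) := by
    rw [Measure.prod_restrict]; rfl
  have hGm : Measurable G := by
    refine Real.measurable_log.comp (Continuous.measurable ?_)
    fun_prop
  have hslice : ∀ s, IntegrableOn (fun t => G (s, t)) I := fun s =>
    (intervalIntegrable_iff_integrableOn_Ioc_of_le hpi.le).1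
      (intervalIntegrable_log_abs_cos_add (A s) (B s) (c s))
  have hval : ∀ s, A s ≠ 0 → ∫ t in I, G (s, t)
      = 2 * Real.pi * (Real.log |A s| + posArcosh |B s / (2 * A s)|) := by
    intro s hs
    rw [hI, ← intervalIntegral.integral_of_le hpi.le]
    exact integral_log_abs_cos_add hs (B s) (c s)
  have hA0I : ∀ᵐ s ∂volume.restrict I, A s ≠ 0 := ae_restrict_of_ae hA0
  have hIfin : IsFiniteMeasure (volume.restrict I) :=
    isFiniteMeasure_restrict.2 measure_Ioc_lt_top.ne
  have hbound : ∀ s t, |G (s, t)| ≤ 2 * Real.log M - G (s, t) := by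
    intro s t
    refine abs_log_le_two_mul_log_sub (abs_nonneg _) (le_trans ?_ (hAB s)) hM
    refine (abs_add_le _ _).trans (add_le_add_left ?_ _)
    rw [abs_mul, abs_mul, abs_two]
    exact mul_le_of_le_one_right (by positivity) (Real.abs_cos_le_one _)
  have hint : Integrable G ((volume.restrict I).prod (volume.restrict I)) := by
    rw [integrable_prod_iff hGm.aestronglyMeasurable]
    refine ⟨.of_forall hslice, ?_⟩
    -- The slice norms are dominated by dropping the nonnegative arcosh term from Jensen's value.
    have hdom : Integrable (fun s => 2 * Real.log M * (2 * Real.pi)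
        - 2 * Real.pi * Real.log |A s|) (volume.restrict I) :=
      (integrable_const _).sub (hlog.const_mul _)
    refine hdom.mono' hGm.aestronglyMeasurable.norm.integral_prod_right' ?_
    filter_upwards [hA0I] with s hs
    rw [Real.norm_of_nonneg (integral_nonneg fun t => norm_nonneg _)]
    calc ∫ t in I, ‖G (s, t)‖ ≤ ∫ t in I, (2 * Real.log M - G (s, t)) :=
          integral_mono (hslice s).norm ((integrable_const _).sub (hslice s)) (hbound s)
      _ = 2 * Real.log M * (2 * Real.pi) - ∫ t in I, G (s, t) := by
          rw [integral_sub (integrable_const _) (hslice s)]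
          simp [hI, Real.pi_pos.le, mul_comm]
      _ ≤ _ := by
          rw [hval s hs]
          nlinarith [posArcosh_nonneg |B s / (2 * A s)|]
  have hsum : Integrable (fun s => 2 * Real.pi * (Real.log |A s| + posArcosh |B s / (2 * A s)|))
      (volume.restrict I) := by
    refine hint.integral_prod_left.congr ?_
    filter_upwards [hA0I] with s hs using hval s hs
  have harc : Integrable (fun s => posArcosh |B s / (2 * A s)|) (volume.restrict I) := by
    refine ((hsum.const_mul (2 * Real.pi)⁻¹).sub hlog).congr (.of_forall fun s => ?_)
    simp only [Pi.sub_apply]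
    field_simp
    ring
  refine ⟨?_, harc, ?_⟩
  · rwa [IntegrableOn, hvol]
  · rw [hvol, integral_prod _ hint, ← integral_add hlog harc, ← integral_const_mul]
    refine integral_congr_ae ?_
    filter_upwards [hA0I] with s hs using hval s hs

/-! ### The two polynomials on the torus -/

lemma logNormOnTorus_boydP (k : ℝ) (θ : ℝ × ℝ) :
    logNormOnTorus (boydP k) θ = Real.log |2 * (1 + 2 * Real.cos θ.1) * Real.cos (θ.2 - θ.1 / 2)
      + 2 * k * Real.cos (θ.1 / 2)| := by
  obtain ⟨s, t⟩ := θ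
  set z := Complex.exp ((s / 2 : ℝ) * Complex.I) with hz
  set w := Complex.exp (-(s / 2 : ℝ) * Complex.I) with hw
  set y := Complex.exp (t * Complex.I) with hy
  set y' := Complex.exp (-t * Complex.I) with hy'
  have hzw : z * w = 1 := by rw [hz, hw, ← Complex.exp_add]; simp
  have hyy : y * y' = 1 := by rw [hy, hy', ← Complex.exp_add]; simp
  have hx : Complex.exp (s * Complex.I) = z ^ 2 := by
    rw [hz, ← Complex.exp_nat_mul]; congr 1; push_cast; ring
  have hx' : Complex.exp (-s * Complex.I) = w ^ 2 := by
    rw [hw, ← Complex.exp_nat_mul]; congr 1; push_cast; ring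
  have c1 : 2 * Complex.cos s = z ^ 2 + w ^ 2 := by rw [Complex.two_cos, hx, hx']
  have c2 : 2 * Complex.cos ((s / 2 : ℝ) : ℂ) = z + w := by rw [Complex.two_cos]
  have c3 : 2 * Complex.cos ((t - s / 2 : ℝ) : ℂ) = y * w + y' * z := by
    rw [Complex.two_cos, hy, hw, hy', hz, ← Complex.exp_add, ← Complex.exp_add]
    congr 2 <;> push_cast <;> ring
  -- The `y`-coefficients of `boydP` are symmetric under `y ↦ x / y`, so the natural centre is `y =
  -- √x`; hence the half angle `z = e^{is/2}`.
  have hfac : MvPolynomial.eval ![Complex.exp (s * Complex.I), y] (boydP k)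
      = z ^ 3 * y * ((2 * (1 + 2 * Real.cos s) * Real.cos (t - s / 2)
        + 2 * k * Real.cos (s / 2) : ℝ) : ℂ) := by
    rw [hx]
    simp only [boydP, map_add, map_mul, map_pow, map_one, MvPolynomial.eval_X,
      MvPolynomial.eval_C, Matrix.cons_val_zero, Matrix.cons_val_one]
    push_cast at c1 c2 c3 ⊢
    have e1 : (2 * (1 + 2 * Complex.cos s) * Complex.cos (t - s / 2) + 2 * k * Complex.cos (s / 2))
      = (1 + (z ^ 2 + w ^ 2)) * (y * w + y' * z) + k * (z + w) := by
      rw [← c1, ← c2, ← c3]; ring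
    rw [e1]
    have e2 : z ^ 3 * y * ((1 + (z ^ 2 + w ^ 2)) * (y * w + y' * z) + k * (z + w))
       = (z ^ 2 + z ^ 4 + (z * w) ^ 2) * (y ^ 2 * (z * w) + (y * y') * z ^ 2)
          + k * y * (z ^ 4 + z ^ 2 * (z * w)) := by ring
    rw [e2, hzw, hyy]; ring
  simp only [logNormOnTorus]
  rw [← hy, hfac, norm_mul, norm_mul, norm_pow, hz, hy, Complex.norm_exp_ofReal_mul_I,
    Complex.norm_exp_ofReal_mul_I, Complex.norm_real, Real.norm_eq_abs]
  simp

lemma logNormOnTorus_boydQ (k : ℝ) (θ : ℝ × ℝ) :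
    logNormOnTorus (boydQ k) θ = Real.log |2 * (1 + 2 * Real.cos θ.1) * Real.cos (θ.2 - θ.1)
      + (2 * Real.cos (2 * θ.1) + 2 * k * Real.cos θ.1 + 2 * k - 4)| := by
  obtain ⟨s, t⟩ := θ
  set z := Complex.exp (s * Complex.I) with hz
  set w := Complex.exp (-s * Complex.I) with hw
  set y := Complex.exp (t * Complex.I) with hy
  set y' := Complex.exp (-t * Complex.I) with hy'
  have hzw : z * w = 1 := by rw [hz, hw, ← Complex.exp_add]; simp
  have hyy : y * y' = 1 := by rw [hy, hy', ← Complex.exp_add]; simp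
  have c1 : 2 * Complex.cos s = z + w := by rw [Complex.two_cos]
  have c2 : 2 * Complex.cos (2 * s) = z ^ 2 + w ^ 2 := by
    rw [Complex.two_cos, hz, hw, ← Complex.exp_nat_mul, ← Complex.exp_nat_mul]
    congr 2 <;> push_cast <;> ring
  have c3 : 2 * Complex.cos (t - s) = y * w + y' * z := by
    rw [Complex.two_cos, hy, hw, hy', hz, ← Complex.exp_add, ← Complex.exp_add]
    congr 2 <;> ring
  have hfac : MvPolynomial.eval ![z, y] (boydQ k)
      = z ^ 2 * y * ((2 * (1 + 2 * Real.cos s) * Real.cos (t - s)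
        + (2 * Real.cos (2 * s) + 2 * k * Real.cos s + 2 * k - 4) : ℝ) : ℂ) := by
    simp only [boydQ, map_add, map_mul, map_pow, map_one, MvPolynomial.eval_X,
      MvPolynomial.eval_C, Matrix.cons_val_zero, Matrix.cons_val_one]
    push_cast
    have e1 : (2 * (1 + 2 * Complex.cos s) * Complex.cos (t - s)
        + (2 * Complex.cos (2 * s) + 2 * k * Complex.cos s + 2 * k - 4))
      = (1 + (z + w)) * (y * w + y' * z) + (z ^ 2 + w ^ 2 + k * (z + w) + 2 * k - 4) := by
      rw [← c1, ← c2, ← c3]; ring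
    rw [e1]
    have e2 : z ^ 2 * y * ((1 + (z + w)) * (y * w + y' * z)
          + (z ^ 2 + w ^ 2 + k * (z + w) + 2 * k - 4))
       = (z + z ^ 2 + z * w) * (y ^ 2 * (z * w) + (y * y') * z ^ 2)
          + y * (z ^ 4 + (z * w) ^ 2 + k * (z ^ 3 + z * (z * w)) + (2 * k - 4) * z ^ 2) := by ring
    rw [e2, hzw, hyy]; ring
  simp only [logNormOnTorus]
  rw [← hy, ← hz, hfac, norm_mul, norm_mul, norm_pow, hz, hy, Complex.norm_exp_ofReal_mul_I,
    Complex.norm_exp_ofReal_mul_I, Complex.norm_real, Real.norm_eq_abs]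
  simp

/-! ### The Möbius substitution between the elliptic integrals -/

lemma mobius_sq_add_mul_sub (k u : ℝ) (hw : 1 + k - u ≠ 0) :
    ((4 - 4 * u + k * u) / (1 + k - u)) ^ 2 + k * ((4 - 4 * u + k * u) / (1 + k - u)) - 4
      = (k - 3) * (k ^ 2 * u - 4 * (u - 1) ^ 2) / (1 + k - u) ^ 2 := by
  field_simp
  ring

/-- The elliptic integrals attached to the two families agree by a Möbius substitution. -/
lemma lintegral_elliptic_eq {k : ℝ} (hk : 4 ≤ k) :
    ∫⁻ u in {u ∈ Ioo (0 : ℝ) 4 | 4 * (u - 1) ^ 2 < k ^ 2 * u},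
        ENNReal.ofReal (1 / √((4 - u) * (k ^ 2 * u - 4 * (u - 1) ^ 2)))
      = ∫⁻ v in {v ∈ Ioo (0 : ℝ) 4 | 0 < v ^ 2 + k * v - 4},
        ENNReal.ofReal (1 / √((4 - v) * ((v - 4 + k) * (v ^ 2 + k * v - 4)))) := by
  set S := {u ∈ Ioo (0 : ℝ) 4 | 4 * (u - 1) ^ 2 < k ^ 2 * u} with hS
  -- This map matches branch points: it fixes `4`, sends `∞` to `4 - k`, and sends the roots of `k²u
  -- - 4(u-1)²` to those of `v² + kv - 4`. Its determinant is `k(k-3)`.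
  set f : ℝ → ℝ := fun u => (4 - 4 * u + k * u) / (1 + k - u) with hf
  have hSm : MeasurableSet S :=
    measurableSet_Ioo.inter (measurableSet_lt (f := fun u : ℝ => 4 * (u - 1) ^ 2)
      (g := fun u => k ^ 2 * u) (by fun_prop) (by fun_prop))
  have hw : ∀ u ∈ S, 0 < 1 + k - u := fun u hu => by
    have := hu.1.2
    linarith
  have himg : f '' S = {v ∈ Ioo (0 : ℝ) 4 | 0 < v ^ 2 + k * v - 4} := by
    ext v
    constructor
    · rintro ⟨u, hu, rfl⟩
      have hwu := hw u hu
      obtain ⟨⟨h0, h4⟩, hR⟩ := hu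
      refine ⟨⟨div_pos (by nlinarith) hwu, ?_⟩, ?_⟩
      · rw [hf]
        simp only
        rw [div_lt_iff₀ hwu]; nlinarith
      · simp only [hf]
        rw [mobius_sq_add_mul_sub k u hwu.ne']
        have : 0 < k - 3 := by linarith
        have : 0 < k ^ 2 * u - 4 * (u - 1) ^ 2 := by linarith
        positivity
    · rintro ⟨⟨h0, h4⟩, hR⟩
      have hd : 0 < v - 4 + k := by linarith
      -- The preimage comes from solving `v - 4 + k = k(k-3) / (1 + k - u)` for `u`.
      have hwu : 1 + k - (1 + k - k * (k - 3) / (v - 4 + k)) = k * (k - 3) / (v - 4 + k) := by ring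
      have hwp : 0 < k * (k - 3) / (v - 4 + k) := div_pos (by nlinarith) hd
      have hfu : f (1 + k - k * (k - 3) / (v - 4 + k)) = v := by
        simp only [hf]
        rw [hwu, div_eq_iff hwp.ne']
        field_simp
        ring
      refine ⟨1 + k - k * (k - 3) / (v - 4 + k), ?_, hfu⟩
      set u := 1 + k - k * (k - 3) / (v - 4 + k) with hu
      have hRu : 4 * (u - 1) ^ 2 < k ^ 2 * u := by
        have h1 := mobius_sq_add_mul_sub k u (by rw [hwu]; exact hwp.ne')
        have h2 : (4 - 4 * u + k * u) / (1 + k - u) = v := hfu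
        rw [h2] at h1
        rw [h1] at hR
        have h3 : 0 < (1 + k - u) ^ 2 := by rw [hwu]; positivity
        rw [div_pos_iff_of_pos_right h3] at hR
        have := pos_of_mul_pos_right hR (by linarith)
        linarith
      refine ⟨⟨?_, ?_⟩, hRu⟩
      · have : 0 < k ^ 2 * u := lt_of_le_of_lt (by positivity) hRu
        exact pos_of_mul_pos_right this (by positivity)
      · have : k - 3 < k * (k - 3) / (v - 4 + k) := by
          rw [lt_div_iff₀ hd]; nlinarith
        linarith
  have hder : ∀ u ∈ S, HasDerivWithinAt f (k * (k - 3) / (1 + k - u) ^ 2) S u := by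
    intro u hu
    have hwu := (hw u hu).ne'
    have h1 : HasDerivAt (fun u : ℝ => 4 - 4 * u + k * u) (-4 + k) u := by
      refine HasDerivAt.congr_deriv (((hasDerivAt_id u).const_mul 4).const_sub 4 |>.add
        ((hasDerivAt_id u).const_mul k)) (by ring)
    have h2 : HasDerivAt (fun u : ℝ => 1 + k - u) (-1) u := by
      simpa using (hasDerivAt_id u).const_sub (1 + k)
    refine ((h1.div h2 hwu).congr_deriv ?_).hasDerivWithinAt
    congr 1
    ring
  have hinj : InjOn f S := by
    intro a ha b hb hab
    simp only [hf] at hab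
    rw [div_eq_div_iff (hw a ha).ne' (hw b hb).ne'] at hab
    have h : k * (k - 3) * (a - b) = 0 := by linear_combination hab
    have : k * (k - 3) ≠ 0 := by nlinarith
    have := (mul_eq_zero.1 h).resolve_left this
    linarith
  rw [← himg, lintegral_image_eq_lintegral_abs_deriv_mul hSm hder hinj]
  refine setLIntegral_congr_fun hSm fun u hu => ?_
  have hwu := hw u hu
  obtain ⟨⟨h0, h4⟩, hR⟩ := hu
  have hk3 : 0 < k - 3 := by linarith
  have hk0 : 0 < k := by linarith
  have e1 : 4 - f u = k * (4 - u) / (1 + k - u) := by simp only [hf]; field_simp; ring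
  have e2 : f u - 4 + k = k * (k - 3) / (1 + k - u) := by simp only [hf]; field_simp; ring
  have e3 : f u ^ 2 + k * f u - 4
      = (k - 3) * (k ^ 2 * u - 4 * (u - 1) ^ 2) / (1 + k - u) ^ 2 :=
    mobius_sq_add_mul_sub k u hwu.ne'
  rw [e1, e2, e3]
  -- The radicands differ exactly by the square of the Jacobian.
  have e4 : k * (4 - u) / (1 + k - u) * (k * (k - 3) / (1 + k - u)
      * ((k - 3) * (k ^ 2 * u - 4 * (u - 1) ^ 2) / (1 + k - u) ^ 2))
      = (k * (k - 3) / (1 + k - u) ^ 2) ^ 2 * ((4 - u) * (k ^ 2 * u - 4 * (u - 1) ^ 2)) := by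
    field_simp
  have hc : 0 < k * (k - 3) / (1 + k - u) ^ 2 := by positivity
  rw [e4, Real.sqrt_mul (sq_nonneg (k * (k - 3) / (1 + k - u) ^ 2)), Real.sqrt_sq hc.le, abs_of_pos hc,
    ← ENNReal.ofReal_mul hc.le]
  congr 1
  field_simp

/-- The weight is the Jacobian: `u(4 - u) = (2 sin s)²` when `u = 2 + 2 cos s`. -/
lemma lintegral_comp_two_add_two_mul_cos (f : ℝ → ENNReal) :
    ∫⁻ s in Ioo 0 Real.pi, f (2 + 2 * Real.cos s)
      = ∫⁻ u in Ioo (0 : ℝ) 4, ENNReal.ofReal (1 / √(u * (4 - u))) * f u := by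
  have himg : (fun s => 2 + 2 * Real.cos s) '' Ioo 0 Real.pi = Ioo (0 : ℝ) 4 := by
    ext u
    constructor
    · rintro ⟨s, ⟨h0, hp⟩, rfl⟩
      have h1 := Real.cos_lt_cos_of_nonneg_of_le_pi le_rfl hp.le h0
      have h2 := Real.cos_lt_cos_of_nonneg_of_le_pi h0.le le_rfl hp
      rw [Real.cos_zero] at h1
      rw [Real.cos_pi] at h2
      constructor <;> simp only <;> linarith
    · rintro ⟨h0, h4⟩
      refine ⟨Real.arccos ((u - 2) / 2), ⟨Real.arccos_pos.2 (by linarith), ?_⟩, ?_⟩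
      · refine lt_of_le_of_ne (Real.arccos_le_pi _) fun h => ?_
        rw [Real.arccos_eq_pi] at h
        linarith
      · simp only
        rw [Real.cos_arccos (by linarith) (by linarith)]; ring
  have hder : ∀ s ∈ Ioo 0 Real.pi, HasDerivWithinAt (fun s => 2 + 2 * Real.cos s)
      (2 * -Real.sin s) (Ioo 0 Real.pi) s := fun s _ =>
    (((Real.hasDerivAt_cos s).const_mul 2).const_add 2).hasDerivWithinAt
  have hinj : InjOn (fun s => 2 + 2 * Real.cos s) (Ioo 0 Real.pi) := by
    intro a ha b hb hab
    simp only at hab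
    exact Real.injOn_cos ⟨ha.1.le, ha.2.le⟩ ⟨hb.1.le, hb.2.le⟩ (by linarith)
  rw [← himg, lintegral_image_eq_lintegral_abs_deriv_mul measurableSet_Ioo hder hinj]
  refine setLIntegral_congr_fun measurableSet_Ioo fun s hs => ?_
  have hsin := Real.sin_pos_of_mem_Ioo hs
  have hsq : (2 + 2 * Real.cos s) * (4 - (2 + 2 * Real.cos s)) = (2 * Real.sin s) ^ 2 := by
    have := Real.sin_sq_add_cos_sq s
    linear_combination (-4) * this
  rw [hsq, Real.sqrt_sq (by positivity), ← mul_assoc, mul_neg, abs_neg, abs_of_pos (by positivity),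
    ← ENNReal.ofReal_mul (by positivity), mul_one_div_cancel (by positivity), ENNReal.ofReal_one,
    one_mul]

lemma lintegral_comp_cos_two_pi (f : ℝ → ENNReal) :
    ∫⁻ s in Ioc 0 (2 * Real.pi), f (2 + 2 * Real.cos s)
      = 2 * ∫⁻ s in Ioo 0 Real.pi, f (2 + 2 * Real.cos s) := by
  have hpi := Real.pi_pos
  have hu : Ioc 0 (2 * Real.pi) = Ioc 0 Real.pi ∪ Ioc Real.pi (2 * Real.pi) :=
    (Ioc_union_Ioc_eq_Ioc hpi.le (by linarith)).symm
  have himg : (fun s => 2 * Real.pi - s) '' Ioo 0 Real.pi = Ioo Real.pi (2 * Real.pi) := by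
    rw [image_const_sub_Ioo]; congr 1 <;> ring
  have h2 : ∫⁻ s in Ioo Real.pi (2 * Real.pi), f (2 + 2 * Real.cos s)
      = ∫⁻ s in Ioo 0 Real.pi, f (2 + 2 * Real.cos s) := by
    rw [← himg, lintegral_image_eq_lintegral_abs_deriv_mul (f := fun s => 2 * Real.pi - s)
      (f' := fun _ => -1) measurableSet_Ioo (fun s _ => ((hasDerivAt_id s).const_sub (2 * Real.pi)).hasDerivWithinAt)
      (fun a _ b _ hab => by simpa using hab)]
    simp [Real.cos_two_pi_sub]
  rw [hu, lintegral_union measurableSet_Ioc (Ioc_disjoint_Ioc_of_le le_rfl),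
    setLIntegral_congr Ioo_ae_eq_Ioc.symm, setLIntegral_congr Ioo_ae_eq_Ioc.symm, h2, two_mul]

/-! ### Differentiation in the parameter -/

/-- The derivative in `k` of `posArcosh (k√u / (2|u-1|))`. -/
noncomputable def densityP (k u : ℝ) : ENNReal :=
  {k : ℝ | 4 * (u - 1) ^ 2 < k ^ 2 * u}.indicator
    (fun k => ENNReal.ofReal (√u / √(k ^ 2 * u - 4 * (u - 1) ^ 2))) k

/-- The derivative in `k` of `posArcosh ((u² - 2u - 2 + ku) / (2|u-1|))`. -/
noncomputable def densityQ (k u : ℝ) : ENNReal :=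
  {k : ℝ | 0 < u ^ 2 + k * u - 4}.indicator
    (fun k => ENNReal.ofReal (u / √(u * (u - 4 + k) * (u ^ 2 + k * u - 4)))) k

/-- The weight `1/√(u(4-u))` absorbs the numerators `√u` and `u` of the densities, leaving the two
integrands of `lintegral_elliptic_eq`. -/
lemma lintegral_densityP_eq_densityQ {k : ℝ} (hk : 4 ≤ k) :
    ∫⁻ s in Ioc 0 (2 * Real.pi), densityP k (2 + 2 * Real.cos s)
      = ∫⁻ s in Ioc 0 (2 * Real.pi), densityQ k (2 + 2 * Real.cos s) := by
  rw [lintegral_comp_cos_two_pi (densityP k), lintegral_comp_cos_two_pi (densityQ k),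
    lintegral_comp_two_add_two_mul_cos, lintegral_comp_two_add_two_mul_cos]
  congr 1
  have key := lintegral_elliptic_eq hk
  rw [ofPred_and, ofPred_and, ofPred_mem_eq, inter_comm, inter_comm (Ioo 0 4),
    ← setLIntegral_indicator (measurableSet_lt (by fun_prop) (by fun_prop)),
    ← setLIntegral_indicator (measurableSet_lt (by fun_prop) (by fun_prop))] at key
  refine Eq.trans (setLIntegral_congr_fun measurableSet_Ioo fun u hu => ?_)
    (key.trans (setLIntegral_congr_fun measurableSet_Ioo fun u hu => ?_))
  · simp only [densityP, indicator_apply, mem_ofPred_eq]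
    split_ifs with h
    · have h4 : 0 < 4 - u := by linarith [hu.2]
      have h0 := hu.1
      have hR : 0 < k ^ 2 * u - 4 * (u - 1) ^ 2 := by linarith
      rw [← ENNReal.ofReal_mul (by positivity), Real.sqrt_mul h0.le, Real.sqrt_mul h4.le]
      congr 1
      have := Real.sqrt_pos.2 h0
      field_simp
    · simp
  · simp only [densityQ, indicator_apply, mem_ofPred_eq]
    split_ifs with h
    · have h4 : 0 < 4 - u := by linarith [hu.2]
      have h0 := hu.1
      have hk4 : 0 < u - 4 + k := by linarith
      rw [← ENNReal.ofReal_mul (by positivity), Real.sqrt_mul h0.le, Real.sqrt_mul h4.le,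
        mul_assoc u, Real.sqrt_mul h0.le]
      congr 1
      have := Real.sqrt_pos.2 h0
      have hs := Real.mul_self_sqrt h0.le
      have := Real.sqrt_pos.2 h4
      have := Real.sqrt_pos.2 (mul_pos hk4 h)
      field_simp
      rw [sq, hs]
    · simp

/-- The fundamental theorem of calculus across the threshold where the argument reaches 1. The
extended nonnegative form allows Tonelli's theorem later without a separate integrability check. -/
lemma ofReal_posArcosh_affine (p : ℝ) {q k K : ℝ} (hq : 0 < q) (hkK : k ≤ K) :
    ENNReal.ofReal (posArcosh (p + q * K)) = ENNReal.ofReal (posArcosh (p + q * k))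
      + ∫⁻ x in Ioc k K, {x | 1 < p + q * x}.indicator
          (fun x => ENNReal.ofReal (q / √((p + q * x) ^ 2 - 1))) x := by
  rcases le_or_gt (p + q * K) 1 with hK | hK
  · have hk : p + q * k ≤ 1 := le_trans (by gcongr) hK
    rw [posArcosh_of_le hK, posArcosh_of_le hk, setLIntegral_congr_fun (g := fun _ => 0)
      measurableSet_Ioc]
    · simp
    · intro x hx
      refine indicator_of_notMem (fun h => ?_) _
      have h1 : q * x ≤ q * K := by gcongr; exact hx.2
      have h2 : 1 < p + q * x := h
      linarith
  -- From `c` onwards the argument exceeds 1; on `[k, c]` nothing accumulates.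
  set c := max k ((1 - p) / q) with hc
  have hkc : k ≤ c := le_max_left _ _
  have hcK : c < K ∨ c = K := by
    rcases hkK.lt_or_eq with h | h
    · left
      refine max_lt h ?_
      rw [div_lt_iff₀ hq]
      linarith
    · right
      rw [hc, h, max_eq_left]
      rw [div_le_iff₀ hq]
      linarith
  have hcK' : c ≤ K := hcK.elim le_of_lt le_of_eq
  have hgt : ∀ x, c < x → 1 < p + q * x := fun x hx => by
    have := (le_max_right k _).trans_lt hx
    rw [div_lt_iff₀ hq] at this
    linarith
  have hcont : Continuous fun x => posArcosh (p + q * x) :=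
    continuous_posArcosh.comp (by fun_prop)
  have hval : posArcosh (p + q * c) = posArcosh (p + q * k) := by
    rcases le_total k ((1 - p) / q) with h | h
    · have hc1 : p + q * c = 1 := by rw [hc, max_eq_right h]; field_simp; ring
      rw [le_div_iff₀ hq] at h
      rw [posArcosh_of_le hc1.le, posArcosh_of_le (by linarith)]
    · rw [hc, max_eq_left h]
  have hder : ∀ x ∈ Ioo c K, HasDerivAt (fun x => posArcosh (p + q * x))
      (q / √((p + q * x) ^ 2 - 1)) x := by
    intro x hx
    have h1 : HasDerivAt (fun x => p + q * x) q x := by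
      simpa using ((hasDerivAt_id x).const_mul q).const_add p
    have h2 := (Real.hasDerivAt_arcosh (hgt x hx.1)).comp x h1
    refine (h2.congr_deriv (by rw [inv_mul_eq_div])).congr_of_eventuallyEq ?_
    filter_upwards [Ioi_mem_nhds hx.1] with y hy
    simp only [posArcosh, Function.comp]
    rw [max_eq_right (hgt y hy).le]
  have hnn : ∀ x, 0 ≤ q / √((p + q * x) ^ 2 - 1) := fun x => by positivity
  -- The derivative may blow up at `c`; it is integrable because it is nonnegative with a continuous
  -- primitive.
  have hint : IntegrableOn (fun x => q / √((p + q * x) ^ 2 - 1)) (Ioc c K) :=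
    intervalIntegral.integrableOn_deriv_of_nonneg hcont.continuousOn hder fun x _ => hnn x
  have hftc := intervalIntegral.integral_eq_sub_of_hasDerivAt_of_le hcK' hcont.continuousOn hder
    ((intervalIntegrable_iff_integrableOn_Ioc_of_le hcK').2 hint)
  rw [intervalIntegral.integral_of_le hcK', hval] at hftc
  have hI : ∫⁻ x in Ioc k K, {x | 1 < p + q * x}.indicator
      (fun x => ENNReal.ofReal (q / √((p + q * x) ^ 2 - 1))) x
      = ∫⁻ x in Ioc c K, ENNReal.ofReal (q / √((p + q * x) ^ 2 - 1)) := by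
    rw [← Ioc_union_Ioc_eq_Ioc hkc hcK',
      lintegral_union measurableSet_Ioc (Ioc_disjoint_Ioc_of_le le_rfl),
      setLIntegral_congr_fun (g := fun _ => 0) measurableSet_Ioc, lintegral_zero, zero_add]
    · exact setLIntegral_congr_fun measurableSet_Ioc fun x hx =>
        indicator_of_mem (s := {x | 1 < p + q * x}) (hgt x hx.1) _
    · intro x hx
      refine indicator_of_notMem (fun h => ?_) _
      have h2 : 1 < p + q * x := h
      rcases le_max_iff.1 hx.2 with h3 | h3
      · exact absurd hx.1 (not_lt.2 h3)
      · rw [le_div_iff₀ hq] at h3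
        linarith
  rw [hI, ← ofReal_integral_eq_lintegral_ofReal hint (.of_forall hnn), hftc,
    ← ENNReal.ofReal_add (posArcosh_nonneg _)]
  · congr 1; ring
  · rw [← hftc]; exact integral_nonneg hnn

lemma ofReal_posArcosh_P {u k K : ℝ} (hu0 : 0 < u) (hu1 : u ≠ 1) (hk : 0 ≤ k) (hkK : k ≤ K) :
    ENNReal.ofReal (posArcosh (K * √u / (2 * |u - 1|)))
      = ENNReal.ofReal (posArcosh (k * √u / (2 * |u - 1|))) + ∫⁻ x in Ioc k K, densityP x u := by
  have hm : 0 < 2 * |u - 1| := by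
    have := abs_pos.2 (sub_ne_zero.2 hu1)
    positivity
  have hm2 : (2 * |u - 1|) ^ 2 = 4 * (u - 1) ^ 2 := by rw [mul_pow, sq_abs]; norm_num
  set m := 2 * |u - 1| with hmdef
  have hs := Real.sqrt_pos.2 hu0
  have hsq := Real.sq_sqrt hu0.le
  have h := ofReal_posArcosh_affine 0 (q := √u / m) (by positivity) hkK
  have e : ∀ x, 0 + √u / m * x = x * √u / m := fun x => by ring
  simp only [e] at h
  rw [h]
  congr 1
  refine setLIntegral_congr_fun measurableSet_Ioc fun x hx => ?_
  have hx0 : 0 < x := hk.trans_lt hx.1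
  have hiff : 1 < x * √u / m ↔ 4 * (u - 1) ^ 2 < x ^ 2 * u := by
    rw [one_lt_div hm, ← hm2, ← hsq, ← mul_pow]
    rw [pow_lt_pow_iff_left₀ hm.le (by positivity) two_ne_zero]
    rw [hsq]
  simp only [densityP, indicator_apply, mem_ofPred_eq, hiff]
  refine if_ctx_congr Iff.rfl (fun h => ?_) fun _ => rfl
  have e2 : (x * √u / m) ^ 2 - 1 = (x ^ 2 * u - 4 * (u - 1) ^ 2) / m ^ 2 := by
    rw [← hm2, div_pow, mul_pow, hsq]; field_simp
  have h3 := Real.sqrt_pos.2 (sub_pos.2 h)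
  rw [e2, Real.sqrt_div' _ (by positivity), Real.sqrt_sq hm.le]
  congr 1
  field_simp

lemma ofReal_posArcosh_Q {u k K : ℝ} (hu0 : 0 < u) (hu1 : u ≠ 1) (hk : 4 ≤ k) (hkK : k ≤ K) :
    ENNReal.ofReal (posArcosh ((u ^ 2 - 2 * u - 2 + K * u) / (2 * |u - 1|)))
      = ENNReal.ofReal (posArcosh ((u ^ 2 - 2 * u - 2 + k * u) / (2 * |u - 1|)))
        + ∫⁻ x in Ioc k K, densityQ x u := by
  have hm : 0 < 2 * |u - 1| := by
    have := abs_pos.2 (sub_ne_zero.2 hu1)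
    positivity
  have hm2 : (2 * |u - 1|) ^ 2 = 4 * (u - 1) ^ 2 := by rw [mul_pow, sq_abs]; norm_num
  set m := 2 * |u - 1| with hmdef
  have h := ofReal_posArcosh_affine ((u ^ 2 - 2 * u - 2) / m) (q := u / m) (by positivity) hkK
  have e : ∀ x, (u ^ 2 - 2 * u - 2) / m + u / m * x = (u ^ 2 - 2 * u - 2 + x * u) / m :=
    fun x => by ring
  simp only [e] at h
  rw [h]
  congr 1
  refine setLIntegral_congr_fun measurableSet_Ioc fun x hx => ?_
  have hx4 : 4 < x := hk.trans_lt hx.1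
  have hpos : 0 < u * (u - 4 + x) := mul_pos hu0 (by linarith)
  -- With `N` the numerator, `N - 2(u-1) = u(u-4+x)` and `N + 2(u-1) = u² + xu - 4`. The first is
  -- positive because `x > 4`, so only the second decides whether `N > 2|u-1|`.
  have hiff : 1 < (u ^ 2 - 2 * u - 2 + x * u) / m ↔ 0 < u ^ 2 + x * u - 4 := by
    rw [one_lt_div hm, hmdef, ← abs_two, ← abs_mul, abs_lt, abs_two]
    constructor
    · rintro ⟨h1, h2⟩; linarith
    · intro h1; constructor <;> nlinarith
  simp only [densityQ, indicator_apply, mem_ofPred_eq, hiff]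
  refine if_ctx_congr Iff.rfl (fun h => ?_) fun _ => rfl
  have e2 : ((u ^ 2 - 2 * u - 2 + x * u) / m) ^ 2 - 1
      = u * (u - 4 + x) * (u ^ 2 + x * u - 4) / m ^ 2 := by
    field_simp
    rw [hm2]; ring
  have h3 := Real.sqrt_pos.2 (mul_pos hpos h)
  rw [e2, Real.sqrt_div' _ (by positivity), Real.sqrt_sq hm.le]
  congr 1
  field_simp

/-! ### Behaviour for large parameter -/

/-- This is `log b ≤ arcosh b ≤ log (2b)` with `b = max m x / m`. The term `log m` is kept apart so
that it cancels between two arguments with the same denominator. -/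
lemma posArcosh_div_bounds {m x : ℝ} (hm : 0 < m) :
    Real.log (max m x) - Real.log m ≤ posArcosh (x / m) ∧
      posArcosh (x / m) ≤ Real.log 2 + (Real.log (max m x) - Real.log m) := by
  have hX : 0 < max m x := lt_max_of_lt_left hm
  have e : max 1 (x / m) = max m x / m := by
    rw [← div_self hm.ne', max_div_div_right hm.le]
  have h1 : 1 ≤ max m x / m := e ▸ le_max_left _ _
  have h0 : 0 < max m x / m := by positivity
  rw [← Real.log_div hX.ne' hm.ne', posArcosh, e, Real.arcosh, ← Real.log_mul two_ne_zero h0.ne']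
  have hs := Real.sqrt_nonneg ((max m x / m) ^ 2 - 1)
  have hs2 : √((max m x / m) ^ 2 - 1) ≤ max m x / m := by
    rw [Real.sqrt_le_left h0.le]; linarith
  exact ⟨Real.log_le_log h0 (by linarith), Real.log_le_log (by linarith) (by linarith)⟩

/-- Supplies the dominating function, uniform in `K`: the truncated numerators `X`, `Y` satisfy `u X
≤ 12 Y` and `√u Y ≤ 12 X`. -/
lemma abs_posArcosh_sub_le {u K : ℝ} (hu0 : 0 < u) (hu4 : u ≤ 4) (hu1 : u ≠ 1) (hK : 12 ≤ K) :
    |posArcosh (K * √u / (2 * |u - 1|)) - posArcosh ((u ^ 2 - 2 * u - 2 + K * u) / (2 * |u - 1|))|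
      ≤ Real.log 2 + Real.log 12 + |Real.log u| := by
  have hm : 0 < 2 * |u - 1| := by
    have := abs_pos.2 (sub_ne_zero.2 hu1)
    positivity
  have hm6 : 2 * |u - 1| ≤ 6 := by
    have : |u - 1| ≤ 3 := abs_le.2 ⟨by linarith, by linarith⟩
    linarith
  obtain ⟨p1, p2⟩ := posArcosh_div_bounds (x := K * √u) hm
  obtain ⟨q1, q2⟩ := posArcosh_div_bounds (x := u ^ 2 - 2 * u - 2 + K * u) hm
  have hs0 := Real.sqrt_pos.2 hu0
  have hs2 : √u ≤ 2 := by
    rw [Real.sqrt_le_left (by norm_num)]; linarith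
  -- If `Ku ≥ 6`, then `(u-1)² - 3 + Ku ≥ Ku/2`. Otherwise `K ≥ 12` forces `u ≤ 1/2`, so `2|u-1| ≥
  -- 1`.
  have hlow : K * u ≤ 6 * max (2 * |u - 1|) (u ^ 2 - 2 * u - 2 + K * u) := by
    rcases le_total 6 (K * u) with h | h
    · have := le_max_right (2 * |u - 1|) (u ^ 2 - 2 * u - 2 + K * u)
      nlinarith [sq_nonneg (u - 1)]
    · have h1 := le_max_left (2 * |u - 1|) (u ^ 2 - 2 * u - 2 + K * u)
      have h2 : u ≤ 1 / 2 := by nlinarith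
      have h3 : 1 / 2 ≤ |u - 1| := by rw [abs_sub_comm]; exact le_trans (by linarith) (le_abs_self _)
      linarith
  set m := 2 * |u - 1|
  set X := max m (K * √u) with hX
  set Y := max m (u ^ 2 - 2 * u - 2 + K * u) with hY
  have hX0 : 0 < X := lt_max_of_lt_left hm
  have hY0 : 0 < Y := lt_max_of_lt_left hm
  have hXY : u * X ≤ 12 * Y := by
    have : X ≤ 2 * K := max_le (by linarith) (by nlinarith)
    nlinarith
  have hYX : √u * Y ≤ 12 * X := by
    have hXl := le_max_left m (K * √u)
    have hXr := le_max_right m (K * √u)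
    rw [hY, mul_max_of_nonneg _ _ hs0.le]
    refine max_le (by nlinarith) ?_
    have : u ^ 2 - 2 * u - 2 + K * u ≤ 8 * K := by nlinarith
    nlinarith
  have l1 := Real.log_le_log (by positivity) hXY
  have l2 := Real.log_le_log (by positivity) hYX
  rw [Real.log_mul hu0.ne' hX0.ne', Real.log_mul (by norm_num) hY0.ne'] at l1
  rw [Real.log_mul hs0.ne' hY0.ne', Real.log_mul (by norm_num) hX0.ne', Real.log_sqrt hu0.le] at l2
  have a1 := neg_abs_le (Real.log u)
  have a2 := abs_nonneg (Real.log u)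
  rw [abs_le]
  constructor <;> linarith

lemma tendsto_posArcosh_sub_log : Tendsto (fun b => posArcosh b - Real.log b) atTop
    (𝓝 (Real.log 2)) := by
  have h : Tendsto (fun b : ℝ => Real.log (1 + √(1 - b⁻¹ ^ 2))) atTop (𝓝 (Real.log 2)) := by
    have h1 : ContinuousAt (fun y : ℝ => Real.log (1 + √(1 - y ^ 2))) 0 :=
      ContinuousAt.log (by fun_prop) (by norm_num)
    have h2 := h1.tendsto.comp tendsto_inv_atTop_zero
    simpa [one_add_one_eq_two, Function.comp_def] using h2
  refine h.congr' ?_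
  filter_upwards [eventually_ge_atTop 1] with b hb
  have hb0 : 0 < b := by linarith
  have e : √(b ^ 2 - 1) = b * √(1 - b⁻¹ ^ 2) := by
    rw [show b ^ 2 - 1 = b ^ 2 * (1 - b⁻¹ ^ 2) by field_simp, Real.sqrt_mul (by positivity),
      Real.sqrt_sq hb0.le]
  have : 0 < 1 + √(1 - b⁻¹ ^ 2) := by positivity
  rw [posArcosh_of_ge hb, e, show b + b * √(1 - b⁻¹ ^ 2) = b * (1 + √(1 - b⁻¹ ^ 2)) by ring,
    Real.log_mul hb0.ne' this.ne']
  ring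

/-- Both terms behave like `log (2b)`, and the ratio of the second argument to the first tends to
`√u`. -/
lemma tendsto_posArcosh_sub {u : ℝ} (hu0 : 0 < u) (hu1 : u ≠ 1) :
    Tendsto (fun K => posArcosh (K * √u / (2 * |u - 1|))
      - posArcosh ((u ^ 2 - 2 * u - 2 + K * u) / (2 * |u - 1|))) atTop
      (𝓝 (-(1 / 2) * Real.log u)) := by
  have hm : 0 < 2 * |u - 1| := by
    have := abs_pos.2 (sub_ne_zero.2 hu1)
    positivity
  set m := 2 * |u - 1|
  have hs0 := Real.sqrt_pos.2 hu0
  have hP : Tendsto (fun K : ℝ => K * √u / m) atTop atTop :=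
    (tendsto_id.atTop_mul_const hs0).atTop_div_const hm
  have hQ : Tendsto (fun K : ℝ => (u ^ 2 - 2 * u - 2 + K * u) / m) atTop atTop :=
    (tendsto_atTop_add_const_left _ _ (tendsto_id.atTop_mul_const hu0)).atTop_div_const hm
  have hratio : Tendsto (fun K : ℝ => Real.log ((u ^ 2 - 2 * u - 2) * (K⁻¹ / √u) + √u)) atTop
      (𝓝 (Real.log √u)) := by
    have h1 : ContinuousAt (fun y : ℝ => Real.log ((u ^ 2 - 2 * u - 2) * (y / √u) + √u)) 0 :=
      ContinuousAt.log (by fun_prop) (by simpa using hs0.ne')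
    have h2 := h1.tendsto.comp tendsto_inv_atTop_zero
    simpa [Function.comp_def] using h2
  have hlim := ((tendsto_posArcosh_sub_log.comp hP).sub
    (tendsto_posArcosh_sub_log.comp hQ)).sub hratio
  rw [Real.log_sqrt hu0.le, sub_self, zero_sub] at hlim
  rw [show -(1 / 2) * Real.log u = -(Real.log u / 2) by ring]
  refine hlim.congr' ?_
  filter_upwards [eventually_gt_atTop 0, hP.eventually_gt_atTop 0, hQ.eventually_gt_atTop 0]
    with K hK hPK hQK
  have hB : 0 < u ^ 2 - 2 * u - 2 + K * u := by
    rwa [div_pos_iff_of_pos_right hm] at hQK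
  have e : (u ^ 2 - 2 * u - 2) * (K⁻¹ / √u) + √u
      = ((u ^ 2 - 2 * u - 2 + K * u) / m) / (K * √u / m) := by
    have := Real.mul_self_sqrt hu0.le
    field_simp
    rw [Real.sq_sqrt hu0.le]; ring
  simp only [Function.comp_apply]
  rw [e, Real.log_div hQK.ne' hPK.ne']
  ring

/-! ### Null sets and logarithmic integrals of cosines -/

lemma ae_cos_ne (c : ℝ) : ∀ᵐ s : ℝ, Real.cos s ≠ c := by
  have han : AnalyticOnNhd ℝ (fun s => Real.cos s - c) univ := fun _ _ => by fun_prop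
  obtain ⟨x, hx⟩ : ∃ x, Real.cos x - c ≠ 0 := by
    by_contra! h
    have h0 := h 0
    have h1 := h Real.pi
    rw [Real.cos_zero] at h0
    rw [Real.cos_pi] at h1
    linarith
  have h := han.preimage_zero_mem_codiscrete hx
  have h2 := ae_restrict_le_codiscreteWithin (μ := volume) MeasurableSet.univ h
  rw [Measure.restrict_univ] at h2
  filter_upwards [h2] with s hs
  simpa [sub_eq_zero] using hs

lemma integrableOn_log_two_add_two_mul_cos :
    IntegrableOn (fun s => Real.log (2 + 2 * Real.cos s)) (Ioc 0 (2 * Real.pi)) := by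
  have h := (intervalIntegrable_iff_integrableOn_Ioc_of_le Real.two_pi_pos.le).1
    (intervalIntegrable_log_abs_cos_add 1 2 0)
  refine h.congr_fun (fun s _ => ?_) measurableSet_Ioc
  simp only [Real.log_abs, sub_zero]
  congr 1; ring

/-- This is the Mahler measure of `(y + 1)²`: here `B / (2A) = 1`, so the arcosh term vanishes. -/
lemma integral_log_two_add_two_mul_cos :
    ∫ s in Ioc 0 (2 * Real.pi), Real.log (2 + 2 * Real.cos s) = 0 := by
  have h := integral_log_abs_cos_add one_ne_zero 2 0
  rw [intervalIntegral.integral_of_le Real.two_pi_pos.le] at h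
  rw [posArcosh_of_le (by norm_num)] at h
  simp only [Real.log_abs, sub_zero, Real.log_one, add_zero, mul_zero] at h
  refine Eq.trans (integral_congr_ae (.of_forall fun s => ?_)) h
  simp only
  congr 1; ring

lemma integrableOn_log_abs_one_add_two_mul_cos :
    IntegrableOn (fun s => Real.log |1 + 2 * Real.cos s|) (Ioc 0 (2 * Real.pi)) := by
  have h := (intervalIntegrable_iff_integrableOn_Ioc_of_le Real.two_pi_pos.le).1
    (intervalIntegrable_log_abs_cos_add 1 1 0)
  refine h.congr_fun (fun s _ => ?_) measurableSet_Ioc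
  simp only [sub_zero]
  congr 2; ring

/-! ### Slices of the two Mahler measures -/

/-- The part of the slice Mahler measure of `boydP k` depending on `k`. -/
noncomputable def sliceP (k s : ℝ) : ℝ :=
  posArcosh (k * √(2 + 2 * Real.cos s) / (2 * |2 + 2 * Real.cos s - 1|))

/-- The part of the slice Mahler measure of `boydQ (k + 2)` depending on `k`. -/
noncomputable def sliceQ (k s : ℝ) : ℝ :=
  posArcosh (((2 + 2 * Real.cos s) ^ 2 - 2 * (2 + 2 * Real.cos s) - 2 + k * (2 + 2 * Real.cos s))
    / (2 * |2 + 2 * Real.cos s - 1|))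

lemma ae_one_add_two_mul_cos_ne_zero : ∀ᵐ s : ℝ, 1 + 2 * Real.cos s ≠ 0 := by
  filter_upwards [ae_cos_ne (-1 / 2)] with s hs h
  exact hs (by linarith)

lemma abs_one_add_two_mul_cos_le (s : ℝ) : |1 + 2 * Real.cos s| ≤ 3 :=
  abs_le.2 ⟨by linarith [Real.neg_one_le_cos s], by linarith [Real.cos_le_one s]⟩

lemma boydP_integrals {k : ℝ} (hk : 0 ≤ k) :
    IntegrableOn (logNormOnTorus (boydP k)) torusAngles ∧
    IntegrableOn (sliceP k) (Ioc 0 (2 * Real.pi)) ∧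
    ∫ θ in torusAngles, logNormOnTorus (boydP k) θ
      = 2 * Real.pi * ((∫ s in Ioc 0 (2 * Real.pi), Real.log |1 + 2 * Real.cos s|)
        + ∫ s in Ioc 0 (2 * Real.pi), sliceP k s) := by
  have h := integrableOn_torusAngles_log_abs_cos_add (A := fun s => 1 + 2 * Real.cos s)
    (B := fun s => 2 * k * Real.cos (s / 2)) (c := fun s => s / 2) (M := 6 + 2 * k)
    (by fun_prop) (by fun_prop) (by fun_prop) (by linarith) (fun s => by
      have h1 := abs_one_add_two_mul_cos_le s
      have h2 : |2 * k * Real.cos (s / 2)| ≤ 2 * k := by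
        rw [abs_mul, abs_of_nonneg (by positivity)]
        exact mul_le_of_le_one_right (by positivity) (Real.abs_cos_le_one _)
      linarith) ae_one_add_two_mul_cos_ne_zero integrableOn_log_abs_one_add_two_mul_cos
  have e1 : logNormOnTorus (boydP k) = fun θ => Real.log |2 * (1 + 2 * Real.cos θ.1)
      * Real.cos (θ.2 - θ.1 / 2) + 2 * k * Real.cos (θ.1 / 2)| := funext (logNormOnTorus_boydP k)
  have e2 : sliceP k = fun s => posArcosh |2 * k * Real.cos (s / 2) / (2 * (1 + 2 * Real.cos s))| := by
    ext s
    have hc : 2 + 2 * Real.cos s = (2 * Real.cos (s / 2)) ^ 2 := by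
      have := Real.cos_sq (s / 2)
      rw [mul_div_cancel₀ _ two_ne_zero] at this
      linear_combination (-4) * this
    rw [sliceP, show 2 + 2 * Real.cos s - 1 = 1 + 2 * Real.cos s by ring, hc, Real.sqrt_sq_eq_abs,
      abs_div, abs_mul 2, abs_two, abs_mul, abs_mul 2 k, abs_two, abs_of_nonneg hk, abs_mul, abs_two]
    congr 2; ring
  rw [e1, e2]
  exact h

lemma boydQ_integrals {k : ℝ} (hk : 4 ≤ k) :
    IntegrableOn (logNormOnTorus (boydQ (k + 2))) torusAngles ∧
    IntegrableOn (sliceQ k) (Ioc 0 (2 * Real.pi)) ∧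
    ∫ θ in torusAngles, logNormOnTorus (boydQ (k + 2)) θ
      = 2 * Real.pi * ((∫ s in Ioc 0 (2 * Real.pi), Real.log |1 + 2 * Real.cos s|)
        + ∫ s in Ioc 0 (2 * Real.pi), sliceQ k s) := by
  have hB : ∀ s, 2 * Real.cos (2 * s) + 2 * (k + 2) * Real.cos s + 2 * (k + 2) - 4
      = (2 + 2 * Real.cos s) ^ 2 - 2 * (2 + 2 * Real.cos s) - 2 + k * (2 + 2 * Real.cos s) := by
    intro s
    rw [Real.cos_two_mul]; ring
  have hu0 : ∀ s, 0 ≤ 2 + 2 * Real.cos s := fun s => by linarith [Real.neg_one_le_cos s]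
  have hu4 : ∀ s, 2 + 2 * Real.cos s ≤ 4 := fun s => by linarith [Real.cos_le_one s]
  have h := integrableOn_torusAngles_log_abs_cos_add (A := fun s => 1 + 2 * Real.cos s)
    (B := fun s => 2 * Real.cos (2 * s) + 2 * (k + 2) * Real.cos s + 2 * (k + 2) - 4)
    (c := fun s => s) (M := 20 + 4 * k)
    (by fun_prop) (by fun_prop) (by fun_prop) (by linarith) (fun s => by
      have h1 := abs_one_add_two_mul_cos_le s
      have h2 := hu0 s
      have h3 := hu4 s
      simp only [hB]
      have : |(2 + 2 * Real.cos s) ^ 2 - 2 * (2 + 2 * Real.cos s) - 2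
          + k * (2 + 2 * Real.cos s)| ≤ 14 + 4 * k :=
        abs_le.2 ⟨by nlinarith, by nlinarith⟩
      linarith) ae_one_add_two_mul_cos_ne_zero integrableOn_log_abs_one_add_two_mul_cos
  have e1 : logNormOnTorus (boydQ (k + 2)) = fun θ => Real.log |2 * (1 + 2 * Real.cos θ.1)
      * Real.cos (θ.2 - θ.1) + (2 * Real.cos (2 * θ.1) + 2 * (k + 2) * Real.cos θ.1
        + 2 * (k + 2) - 4)| := funext fun θ => by rw [logNormOnTorus_boydQ]
  have e2 : sliceQ k = fun s => posArcosh |(2 * Real.cos (2 * s) + 2 * (k + 2) * Real.cos s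
      + 2 * (k + 2) - 4) / (2 * (1 + 2 * Real.cos s))| := by
    ext s
    rw [hB, sliceQ, show 2 + 2 * Real.cos s - 1 = 1 + 2 * Real.cos s by ring, abs_div, abs_mul 2,
      abs_two]
    set u := 2 + 2 * Real.cos s with hu
    have hA : 1 + 2 * Real.cos s = u - 1 := by rw [hu]; ring
    rw [hA]
    rcases le_or_gt 0 (u ^ 2 - 2 * u - 2 + k * u) with h0 | h0
    · rw [abs_of_nonneg h0]
    -- A negative numerator `N` makes both sides zero: `N - 2(u-1) = u(u-4+k) ≥ 0` gives `|N| ≤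
    -- 2|u-1|`.
    · have hge : |u ^ 2 - 2 * u - 2 + k * u| ≤ 2 * |u - 1| := by
        rw [abs_of_neg h0]
        have h1 : 0 ≤ u * (u - 4 + k) := mul_nonneg (hu0 s) (by linarith [hu0 s])
        have h2 := neg_abs_le (u - 1)
        rcases abs_choice (u - 1) with h | h <;> rw [h] at h2 ⊢ <;> nlinarith
      rw [posArcosh_of_le, posArcosh_of_le]
      · exact div_le_one_of_le₀ hge (by positivity)
      · exact (div_nonpos_of_nonpos_of_nonneg h0.le (by positivity)).trans zero_le_one
  rw [e1, e2]
  exact h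

lemma measurable_densityP_uncurry :
    Measurable (Function.uncurry fun s k => densityP k (2 + 2 * Real.cos s)) := by
  have : (Function.uncurry fun s k => densityP k (2 + 2 * Real.cos s))
      = {q : ℝ × ℝ | 4 * ((2 + 2 * Real.cos q.1) - 1) ^ 2 < q.2 ^ 2 * (2 + 2 * Real.cos q.1)}.indicator
        fun q => ENNReal.ofReal (√(2 + 2 * Real.cos q.1)
          / √(q.2 ^ 2 * (2 + 2 * Real.cos q.1) - 4 * ((2 + 2 * Real.cos q.1) - 1) ^ 2)) := rfl
  rw [this]
  exact Measurable.indicator (by fun_prop) (measurableSet_lt (by fun_prop) (by fun_prop))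

lemma measurable_densityQ_uncurry :
    Measurable (Function.uncurry fun s k => densityQ k (2 + 2 * Real.cos s)) := by
  have : (Function.uncurry fun s k => densityQ k (2 + 2 * Real.cos s))
      = {q : ℝ × ℝ | 0 < (2 + 2 * Real.cos q.1) ^ 2 + q.2 * (2 + 2 * Real.cos q.1) - 4}.indicator
        fun q => ENNReal.ofReal ((2 + 2 * Real.cos q.1)
          / √((2 + 2 * Real.cos q.1) * ((2 + 2 * Real.cos q.1) - 4 + q.2)
            * ((2 + 2 * Real.cos q.1) ^ 2 + q.2 * (2 + 2 * Real.cos q.1) - 4))) := rfl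
  rw [this]
  exact Measurable.indicator (by fun_prop) (measurableSet_lt (by fun_prop) (by fun_prop))

lemma ae_two_add_two_mul_cos :
    ∀ᵐ s : ℝ, 0 < 2 + 2 * Real.cos s ∧ 2 + 2 * Real.cos s ≠ 1 := by
  filter_upwards [ae_cos_ne (-1), ae_one_add_two_mul_cos_ne_zero] with s hs h1
  have := lt_of_le_of_ne (Real.neg_one_le_cos s) hs.symm
  exact ⟨by linarith, fun h => h1 (by linarith)⟩

/-! ### Constancy of the difference and its limit -/

lemma integral_sliceP_sub_eq {k K : ℝ} (hk : 4 ≤ k) (hkK : k ≤ K) :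
    (∫ s in Ioc 0 (2 * Real.pi), sliceP K s) - ∫ s in Ioc 0 (2 * Real.pi), sliceP k s
      = (∫ s in Ioc 0 (2 * Real.pi), sliceQ K s) - ∫ s in Ioc 0 (2 * Real.pi), sliceQ k s := by
  have hP : ∀ k, 4 ≤ k → IntegrableOn (sliceP k) (Ioc 0 (2 * Real.pi)) := fun k hk =>
    (boydP_integrals (by linarith)).2.1
  have hQ : ∀ k, 4 ≤ k → IntegrableOn (sliceQ k) (Ioc 0 (2 * Real.pi)) := fun k hk =>
    (boydQ_integrals hk).2.1
  have hPl : ∀ k, 4 ≤ k → ENNReal.ofReal (∫ s in Ioc 0 (2 * Real.pi), sliceP k s)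
      = ∫⁻ s in Ioc 0 (2 * Real.pi), ENNReal.ofReal (sliceP k s) := fun k hk =>
    ofReal_integral_eq_lintegral_ofReal (hP k hk) (.of_forall fun s => posArcosh_nonneg _)
  have hQl : ∀ k, 4 ≤ k → ENNReal.ofReal (∫ s in Ioc 0 (2 * Real.pi), sliceQ k s)
      = ∫⁻ s in Ioc 0 (2 * Real.pi), ENNReal.ofReal (sliceQ k s) := fun k hk =>
    ofReal_integral_eq_lintegral_ofReal (hQ k hk) (.of_forall fun s => posArcosh_nonneg _)
  have hPn : ∀ k, 0 ≤ ∫ s in Ioc 0 (2 * Real.pi), sliceP k s := fun k =>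
    integral_nonneg fun s => posArcosh_nonneg _
  have hQn : ∀ k, 0 ≤ ∫ s in Ioc 0 (2 * Real.pi), sliceQ k s := fun k =>
    integral_nonneg fun s => posArcosh_nonneg _
  have hae : ∀ᵐ s ∂volume.restrict (Ioc 0 (2 * Real.pi)),
      0 < 2 + 2 * Real.cos s ∧ 2 + 2 * Real.cos s ≠ 1 := ae_restrict_of_ae ae_two_add_two_mul_cos
  have hK : 4 ≤ K := hk.trans hkK
  have hDP : ENNReal.ofReal (∫ s in Ioc 0 (2 * Real.pi), sliceP K s)
      = ENNReal.ofReal (∫ s in Ioc 0 (2 * Real.pi), sliceP k s)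
        + ∫⁻ x in Ioc k K, ∫⁻ s in Ioc 0 (2 * Real.pi), densityP x (2 + 2 * Real.cos s) := by
    rw [← lintegral_lintegral_swap measurable_densityP_uncurry.aemeasurable, hPl K hK, hPl k hk,
      ← lintegral_add_left' (hP k hk).aemeasurable.ennreal_ofReal]
    refine lintegral_congr_ae ?_
    filter_upwards [hae] with s hs using ofReal_posArcosh_P hs.1 hs.2 (by linarith) hkK
  have hDQ : ENNReal.ofReal (∫ s in Ioc 0 (2 * Real.pi), sliceQ K s)
      = ENNReal.ofReal (∫ s in Ioc 0 (2 * Real.pi), sliceQ k s)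
        + ∫⁻ x in Ioc k K, ∫⁻ s in Ioc 0 (2 * Real.pi), densityQ x (2 + 2 * Real.cos s) := by
    rw [← lintegral_lintegral_swap measurable_densityQ_uncurry.aemeasurable, hQl K hK, hQl k hk,
      ← lintegral_add_left' (hQ k hk).aemeasurable.ennreal_ofReal]
    refine lintegral_congr_ae ?_
    filter_upwards [hae] with s hs using ofReal_posArcosh_Q hs.1 hs.2 hk hkK
  rw [setLIntegral_congr_fun measurableSet_Ioc
    fun x hx => lintegral_densityP_eq_densityQ (hk.trans hx.1.le)] at hDP
  set D := ∫⁻ x in Ioc k K, ∫⁻ s in Ioc 0 (2 * Real.pi), densityQ x (2 + 2 * Real.cos s)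
  -- Finiteness comes from the identity itself, whose left side is the integral of an integrable
  -- slice; this allows cancelling `D`.
  have hD : D ≠ ⊤ := by
    refine ne_top_of_le_ne_top (b := ENNReal.ofReal (∫ s in Ioc 0 (2 * Real.pi), sliceQ K s))
      ENNReal.ofReal_ne_top ?_
    rw [hDQ]
    exact le_add_self
  have tP := congrArg ENNReal.toReal hDP
  have tQ := congrArg ENNReal.toReal hDQ
  rw [ENNReal.toReal_add ENNReal.ofReal_ne_top hD, ENNReal.toReal_ofReal (hPn _),
    ENNReal.toReal_ofReal (hPn _)] at tP
  rw [ENNReal.toReal_add ENNReal.ofReal_ne_top hD, ENNReal.toReal_ofReal (hQn _),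
    ENNReal.toReal_ofReal (hQn _)] at tQ
  linarith

lemma tendsto_integral_sliceP_sub_sliceQ :
    Tendsto (fun K => (∫ s in Ioc 0 (2 * Real.pi), sliceP K s)
      - ∫ s in Ioc 0 (2 * Real.pi), sliceQ K s) atTop (𝓝 0) := by
  have hae : ∀ᵐ s ∂volume.restrict (Ioc 0 (2 * Real.pi)),
      0 < 2 + 2 * Real.cos s ∧ 2 + 2 * Real.cos s ≠ 1 := ae_restrict_of_ae ae_two_add_two_mul_cos
  have hlim : Tendsto (fun K => ∫ s in Ioc 0 (2 * Real.pi), (sliceP K s - sliceQ K s)) atTop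
      (𝓝 (∫ s in Ioc 0 (2 * Real.pi), -(1 / 2) * Real.log (2 + 2 * Real.cos s))) := by
    refine tendsto_integral_filter_of_dominated_convergence
      (fun s => Real.log 2 + Real.log 12 + |Real.log (2 + 2 * Real.cos s)|) ?_ ?_ ?_ ?_
    · filter_upwards [eventually_ge_atTop 4] with K hK
      exact ((boydP_integrals (by linarith)).2.1.sub (boydQ_integrals hK).2.1).aestronglyMeasurable
    · filter_upwards [eventually_ge_atTop 12] with K hK
      filter_upwards [hae] with s hs
      exact abs_posArcosh_sub_le hs.1 (by linarith [Real.cos_le_one s]) hs.2 hK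
    · exact (integrableOn_const measure_Ioc_lt_top.ne).add
        integrableOn_log_two_add_two_mul_cos.abs
    · filter_upwards [hae] with s hs using tendsto_posArcosh_sub hs.1 hs.2
  rw [integral_const_mul, integral_log_two_add_two_mul_cos, mul_zero] at hlim
  refine hlim.congr' ?_
  filter_upwards [eventually_ge_atTop 4] with K hK
  exact integral_sub (boydP_integrals (by linarith)).2.1 (boydQ_integrals hK).2.1

lemma integral_sliceP_eq_integral_sliceQ {k : ℝ} (hk : 4 ≤ k) :
    ∫ s in Ioc 0 (2 * Real.pi), sliceP k s = ∫ s in Ioc 0 (2 * Real.pi), sliceQ k s := by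
  have hconst : Tendsto (fun K => (∫ s in Ioc 0 (2 * Real.pi), sliceP K s)
      - ∫ s in Ioc 0 (2 * Real.pi), sliceQ K s) atTop
      (𝓝 ((∫ s in Ioc 0 (2 * Real.pi), sliceP k s) - ∫ s in Ioc 0 (2 * Real.pi), sliceQ k s)) := by
    refine tendsto_const_nhds.congr' ?_
    filter_upwards [eventually_ge_atTop k] with K hK
    linarith [integral_sliceP_sub_eq hk hK]
  exact sub_eq_zero.1 (tendsto_nhds_unique hconst tendsto_integral_sliceP_sub_sliceQ)

theorem theorem1 (k : ℝ) (hk : 4 ≤ k) :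
    MeasureTheory.IntegrableOn (logNormOnTorus (boydP k)) torusAngles ∧
    MeasureTheory.IntegrableOn (logNormOnTorus (boydQ (k + 2))) torusAngles ∧
    logMahlerMeasure₂ (boydP k) = logMahlerMeasure₂ (boydQ (k + 2)) := by
  obtain ⟨hP, -, hPi⟩ := boydP_integrals (show 0 ≤ k by linarith)
  obtain ⟨hQ, -, hQi⟩ := boydQ_integrals hk
  refine ⟨hP, hQ, ?_⟩
  rw [logMahlerMeasure₂, logMahlerMeasure₂, hPi, hQi, integral_sliceP_eq_integral_sliceQ hk]
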